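/- For $d\ge 0$ let $\gamma_d$ be the standard Gaussian measure on $\mathbb{R}^d$. There is a constant $C>0$, independent of $d$, such that for every $d$ and every real-valued function $f\in L^2(\gamma_d)$ whose weak (distributional) gradient $\nabla f$ exists on $\mathbb{R}^d$ and satisfies $|\nabla f|\in L^2(\gamma_d)$, the function $f^2\log\bigl(f^2/\int f^2\,d\gamma_d\bigr)$ is $\gamma_d$-integrable and $$\int f^2\log\Bigl(\frac{f^2}{\int f^2\,d\gamma_d}\Bigr)\,d\gamma_d\;\le\; C\int|\nabla f|^2\,d\gamma_d ,$$ where $|\cdot|$ is the Euclidean norm and the left-hand integrand is read as $0$ wherever $f=0$ (in particular everywhere if $f=0$). -/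

import Mathlib

open MeasureTheory ProbabilityTheory
open scoped ContDiff

/-- `HasWeakGradient f g`: the vector field `g` is the weak (distributional) gradient of `f` on
`ℝ^d`, i.e. both are locally Lebesgue integrable and, for every smooth compactly supported
function `φ` and every direction `v`, `∫ f ∂ᵥφ dx = - ∫ φ ⟨g, v⟩ dx`. -/
def HasWeakGradient {d : ℕ} (f : EuclideanSpace ℝ (Fin d) → ℝ)
    (g : EuclideanSpace ℝ (Fin d) → EuclideanSpace ℝ (Fin d)) : Prop :=
  LocallyIntegrable f volume ∧ LocallyIntegrable g volume ∧
    ∀ φ : EuclideanSpace ℝ (Fin d) → ℝ, ContDiff ℝ ∞ φ → HasCompactSupport φ →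
      ∀ v : EuclideanSpace ℝ (Fin d),
        ∫ x, f x * fderiv ℝ φ x v = - ∫ x, φ x * inner ℝ (g x) v

open Filter Topology Real RealInnerProductSpace

set_option linter.unusedSectionVars false


/-! ### Gaussian averages as a heat semigroup. -/

section HeatFlow

variable {E : Type*} [NormedAddCommGroup E] [InnerProductSpace ℝ E] [FiniteDimensional ℝ E]
  [MeasurableSpace E] [BorelSpace E]
variable {G : Type*} [NormedAddCommGroup G] [NormedSpace ℝ G] [CompleteSpace G]

/-! The averages `gaussianAverage s` form a semigroup in the variance `s ^ 2`. For `Φ t = t * log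
t`, call the average of `Φ F` minus `Φ` of the average of `F` the local entropy. Under composition
of averages it obeys a chain rule: it is the average of the local entropies of the first step plus
the local entropy of the averaged function. Over one short step it is at most `s ^ 2 * ‖∇F‖ ^ 2 / F`
up to order `s ^ 3` (`exists_gaussianAverage_mul_log_sub_le`), and joint convexity of `(v, r) ↦ ‖v‖
^ 2 / r` lets the Fisher term pass through averages (`fisher_gaussianAverage_le`). Cutting unit
variance into many equal steps and summing (`gaussianAverage_mul_log_sub_le`) bounds the entropy of
`F` by `∫ ‖∇F‖ ^ 2 / F` (`BoundedTaylor.entropy_le`). The dimension enters only through the error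
term, which vanishes in the limit.

Taking `F = f ^ 2 + ε` gives the inequality with constant 4 for smooth compactly supported `f`.
Mollification and then cutoffs extend it to weak gradients: the squared norms of `f` and of its
gradient converge, while the entropy only needs lower semicontinuity, which also yields its
integrability (`integral_sq_mul_log_le_of_tendsto`). -/

/-- The average of `F` over a Gaussian of standard deviation `s` centred at `x`. -/
noncomputable def gaussianAverage (s : ℝ) (F : E → G) (x : E) : G :=
  ∫ y, F (x + s • y) ∂(stdGaussian E)

lemma integrable_stdGaussian_of_bounded {H : E → G} {C : ℝ} (hH : Continuous H)
    (hC : ∀ x, ‖H x‖ ≤ C) :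
    Integrable H (stdGaussian E) :=
  have := FiniteDimensional.proper_real E
  Integrable.of_bound hH.aestronglyMeasurable C (ae_of_all _ hC)

lemma integrable_gaussianAverage {F : E → G} {C : ℝ} (hF : Continuous F) (hC : ∀ x, ‖F x‖ ≤ C)
    (s : ℝ) (x : E) : Integrable (fun y ↦ F (x + s • y)) (stdGaussian E) :=
  integrable_stdGaussian_of_bounded (by fun_prop) fun _ ↦ hC _

lemma continuous_gaussianAverage {F : E → G} {C : ℝ} (hF : Continuous F) (hC : ∀ x, ‖F x‖ ≤ C)
    (s : ℝ) : Continuous (gaussianAverage s F) :=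
  continuous_of_dominated (bound := fun _ ↦ C)
    (fun x ↦ (integrable_gaussianAverage hF hC s x).aestronglyMeasurable)
    (fun _ ↦ ae_of_all _ fun _ ↦ hC _) (integrable_const _) (ae_of_all _ fun _ ↦ by fun_prop)

lemma norm_gaussianAverage_le {F : E → G} {C : ℝ} (hC : ∀ x, ‖F x‖ ≤ C) (s : ℝ) (x : E) :
    ‖gaussianAverage s F x‖ ≤ C := by
  simpa using! norm_integral_le_of_norm_le_const (μ := stdGaussian E)
    (ae_of_all _ fun y ↦ hC (x + s • y))

lemma gaussianAverage_mono {F₁ F₂ : E → ℝ} {C₁ C₂ : ℝ} (h₁ : Continuous F₁)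
    (hC₁ : ∀ x, ‖F₁ x‖ ≤ C₁) (h₂ : Continuous F₂) (hC₂ : ∀ x, ‖F₂ x‖ ≤ C₂)
    (h : ∀ x, F₁ x ≤ F₂ x) (s : ℝ) (x : E) : gaussianAverage s F₁ x ≤ gaussianAverage s F₂ x :=
  integral_mono (integrable_gaussianAverage h₁ hC₁ s x) (integrable_gaussianAverage h₂ hC₂ s x)
    fun _ ↦ h _

/-- Characteristic functions multiply under convolution, so the variances add. -/
lemma map_smul_conv_map_smul_stdGaussian (s t : ℝ) :
    ((stdGaussian E).map (t • ·)) ∗ ((stdGaussian E).map (s • ·)) =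
      (stdGaussian E).map (√(s ^ 2 + t ^ 2) • ·) := by
  have h (r : ℝ) : IsProbabilityMeasure ((stdGaussian E).map (r • ·)) :=
    Measure.isProbabilityMeasure_map (by fun_prop)
  apply Measure.ext_of_charFun
  ext v
  rw [charFun_conv, charFun_map_smul, charFun_map_smul, charFun_map_smul]
  simp only [charFun_stdGaussian, norm_smul, ← Complex.exp_add]
  congr 1
  norm_cast
  rw [mul_pow, mul_pow, mul_pow, norm_eq_abs, norm_eq_abs, norm_eq_abs, sq_abs, sq_abs, sq_abs,
    sq_sqrt (by positivity)]
  ring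

lemma gaussianAverage_gaussianAverage {F : E → G} {C : ℝ} (hF : Continuous F)
    (hC : ∀ x, ‖F x‖ ≤ C) (s t : ℝ) (x : E) :
    gaussianAverage t (gaussianAverage s F) x = gaussianAverage (√(s ^ 2 + t ^ 2)) F x := by
  have := FiniteDimensional.proper_real E
  have h : gaussianAverage (√(s ^ 2 + t ^ 2)) F x
      = ∫ z, F (x + z) ∂((stdGaussian E).map (√(s ^ 2 + t ^ 2) • ·)) := by
    rw [integral_map (by fun_prop)
      (Continuous.aestronglyMeasurable (by fun_prop))]
    rfl
  rw [h, ← map_smul_conv_map_smul_stdGaussian, Measure.conv, integral_map (by fun_prop)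
      (Continuous.aestronglyMeasurable (by fun_prop)), Measure.map_prod_map _ _ (by fun_prop) (by fun_prop),
    integral_map (by fun_prop) (Continuous.aestronglyMeasurable (by fun_prop)), integral_prod]
  · simp only [gaussianAverage, Prod.map, add_assoc]
  · exact Integrable.of_bound (Continuous.aestronglyMeasurable (by fun_prop)) C
      (ae_of_all _ fun _ ↦ hC _)

/-! ### Regular densities and convexity of Fisher information. -/

/-- `F` takes values in `[a, b]`, and is continuously differentiable with gradient `V` bounded by
`L`, the first order Taylor remainder being bounded by `K ‖y‖ ^ 2`. -/
structure BoundedTaylor (F : E → ℝ) (V : E → E) (a b L K : ℝ) : Prop where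
  pos : 0 < a
  continuous : Continuous F
  lower : ∀ x, a ≤ F x
  upper : ∀ x, F x ≤ b
  continuous_grad : Continuous V
  norm_grad_le : ∀ x, ‖V x‖ ≤ L
  taylor : ∀ x y, |F (x + y) - F x - ⟪V x, y⟫| ≤ K * ‖y‖ ^ 2

namespace BoundedTaylor

variable {F : E → ℝ} {V : E → E} {a b L K : ℝ}

lemma pos' (h : BoundedTaylor F V a b L K) (x : E) : 0 < F x := h.pos.trans_le (h.lower x)

lemma norm_le (h : BoundedTaylor F V a b L K) (x : E) : ‖F x‖ ≤ b := by
  rw [norm_of_nonneg (h.pos' x).le]; exact h.upper x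

lemma L_nonneg (h : BoundedTaylor F V a b L K) : 0 ≤ L := (norm_nonneg _).trans (h.norm_grad_le 0)

lemma continuous_fisher (h : BoundedTaylor F V a b L K) :
    Continuous fun x ↦ ‖V x‖ ^ 2 / F x :=
  (h.continuous_grad.norm.pow 2).div h.continuous fun x ↦ (h.pos' x).ne'

lemma norm_fisher_le (h : BoundedTaylor F V a b L K) (x : E) : ‖‖V x‖ ^ 2 / F x‖ ≤ L ^ 2 / a := by
  rw [norm_of_nonneg (div_nonneg (by positivity) (h.pos' x).le)]
  exact div_le_div₀ (by positivity) (by gcongr; exact h.norm_grad_le x) h.pos (h.lower x)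

lemma continuous_mul_log (h : BoundedTaylor F V a b L K) :
    Continuous fun x ↦ F x * log (F x) := Real.continuous_mul_log.comp h.continuous

lemma exists_norm_mul_log_le (h : BoundedTaylor F V a b L K) :
    ∃ C, ∀ x, ‖F x * log (F x)‖ ≤ C := by
  obtain ⟨C, hC⟩ := (isCompact_Icc (a := a) (b := b)).exists_bound_of_continuousOn
    Real.continuous_mul_log.continuousOn
  exact ⟨C, fun x ↦ hC _ ⟨h.lower x, h.upper x⟩⟩

/-- All four constants survive averaging, so an estimate uniform over the class may be reused at
every step of the semigroup. -/
lemma gaussianAverage (h : BoundedTaylor F V a b L K) (s : ℝ) :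
    BoundedTaylor (gaussianAverage s F) (gaussianAverage s V) a b L K where
  pos := h.pos
  continuous := continuous_gaussianAverage h.continuous h.norm_le s
  lower x := by
    simpa using! integral_mono (integrable_const a)
      (integrable_gaussianAverage h.continuous h.norm_le s x) fun y ↦ h.lower _
  upper x := by
    simpa using! integral_mono (integrable_gaussianAverage h.continuous h.norm_le s x)
      (integrable_const b) fun y ↦ h.upper _
  continuous_grad := continuous_gaussianAverage h.continuous_grad h.norm_grad_le s
  norm_grad_le := norm_gaussianAverage_le h.norm_grad_le s
  taylor x y := by
    have i₁ := integrable_gaussianAverage h.continuous h.norm_le s (x + y)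
    have i₂ := integrable_gaussianAverage h.continuous h.norm_le s x
    have i₃ := integrable_gaussianAverage h.continuous_grad h.norm_grad_le s x
    have e : _root_.gaussianAverage s F (x + y) - _root_.gaussianAverage s F x
        - ⟪_root_.gaussianAverage s V x, y⟫
        = ∫ z, (F (x + s • z + y) - F (x + s • z) - ⟪V (x + s • z), y⟫) ∂(stdGaussian E) := by
      have i₁' : Integrable (fun z ↦ F (x + s • z + y)) (stdGaussian E) := by
        simpa only [add_right_comm] using i₁
      have e₁ : ∫ z, ⟪V (x + s • z), y⟫ ∂(stdGaussian E)
          = ⟪_root_.gaussianAverage s V x, y⟫ := by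
        simp only [real_inner_comm y]
        exact integral_inner i₃ y
      rw [integral_sub (f := fun z ↦ F (x + s • z + y) - F (x + s • z)) (i₁'.sub i₂)
        (i₃.inner_const y), integral_sub i₁' i₂, e₁]
      simp only [_root_.gaussianAverage, add_right_comm x y]
    rw [e, ← norm_eq_abs]
    simpa using! norm_integral_le_of_norm_le_const (μ := stdGaussian E)
      (ae_of_all _ fun z ↦ (norm_eq_abs _).trans_le (h.taylor (x + s • z) y))

/-- Fisher information is convex: `‖∇ P F‖² / P F ≤ P (‖∇ F‖² / F)`. -/
lemma fisher_gaussianAverage_le (h : BoundedTaylor F V a b L K) (s : ℝ) (x : E) :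
    ‖_root_.gaussianAverage s V x‖ ^ 2 / _root_.gaussianAverage s F x
      ≤ _root_.gaussianAverage s (fun z ↦ ‖V z‖ ^ 2 / F z) x := by
  set p := _root_.gaussianAverage s V x with hp
  set m := _root_.gaussianAverage s F x with hm
  have hm0 : 0 < m := (h.gaussianAverage s).pos' x
  have i₁ := integrable_gaussianAverage h.continuous h.norm_le s x
  have i₂ := integrable_gaussianAverage h.continuous_grad h.norm_grad_le s x
  have i₃ := integrable_gaussianAverage h.continuous_fisher h.norm_fisher_le s x
  -- The left side is the tangent plane of `(v, r) ↦ ‖v‖ ^ 2 / r` at `(p, m)`; the gap is a perfect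
  -- square divided by `F z`. Averaging turns the left side into `‖p‖ ^ 2 / m`.
  have key (z : E) : 2 / m * ⟪p, V z⟫ - ‖p‖ ^ 2 / m ^ 2 * F z ≤ ‖V z‖ ^ 2 / F z := by
    have hF := h.pos' z
    have e : ‖V z - (F z / m) • p‖ ^ 2 / F z
        = ‖V z‖ ^ 2 / F z - (2 / m * ⟪p, V z⟫ - ‖p‖ ^ 2 / m ^ 2 * F z) := by
      rw [norm_sub_sq_real, inner_smul_right, norm_smul, mul_pow, norm_of_nonneg (by positivity),
        real_inner_comm]
      field_simp
      ring
    have : 0 ≤ ‖V z - (F z / m) • p‖ ^ 2 / F z := by positivity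
    linarith
  have := integral_mono (((i₂.const_inner p).const_mul (2 / m)).sub
    (i₁.const_mul (‖p‖ ^ 2 / m ^ 2))) i₃ fun y ↦ key (x + s • y)
  rw [integral_sub' ((i₂.const_inner p).const_mul (2 / m)) (i₁.const_mul (‖p‖ ^ 2 / m ^ 2)),
    integral_const_mul, integral_const_mul, integral_inner i₂] at this
  change 2 / m * ⟪p, p⟫ - ‖p‖ ^ 2 / m ^ 2 * m ≤ _ at this
  rw [real_inner_self_eq_norm_sq] at this
  convert! this using 1
  field_simp
  ring

end BoundedTaylor

/-! ### Short-time entropy and its summation over steps. -/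

lemma integrable_norm_pow_stdGaussian (k : ℕ) :
    Integrable (fun y : E ↦ ‖y‖ ^ k) (stdGaussian E) := by
  have := (IsGaussian.memLp_id (stdGaussian E) k (by simp)).integrable_norm_pow'
  simpa using this

lemma integral_inner_sq_stdGaussian (v : E) :
    ∫ y, ⟪v, y⟫ ^ 2 ∂(stdGaussian E) = ‖v‖ ^ 2 := by
  have h := variance_dual_stdGaussian (innerSL ℝ v)
  rw [variance_of_integral_eq_zero (by fun_prop) (integral_strongDual_stdGaussian _)] at h
  simpa using! h

lemma mul_log_add_le_mul_log {c Y : ℝ} (hc : 0 < c) (hY : 0 < Y) :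
    c * log c + (log c + 1) * (Y - c) ≤ Y * log Y := by
  have := one_sub_inv_le_log_of_pos (div_pos hY hc)
  rw [log_div hY.ne' hc.ne', inv_div] at this
  have := mul_le_mul_of_nonneg_left this hY.le
  have e : Y * (1 - c / Y) = Y - c := by field_simp
  nlinarith

/-- This follows from `log t ≤ t - 1` at `t = Y / c`. The quadratic coefficient `1 / c` is twice
that of the Taylor expansion, which is why the final constant is 4 and not the sharp 2. -/
lemma mul_log_le_mul_log_add {c Y : ℝ} (hc : 0 < c) (hY : 0 < Y) :
    Y * log Y ≤ c * log c + (log c + 1) * (Y - c) + (Y - c) ^ 2 / c := by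
  have := log_le_sub_one_of_pos (div_pos hY hc)
  rw [log_div hY.ne' hc.ne'] at this
  have := mul_le_mul_of_nonneg_left this hY.le
  have e : (Y - c) ^ 2 / c = Y * (Y / c - 1) - Y + c := by field_simp; ring
  nlinarith

namespace BoundedTaylor

variable {F : E → ℝ} {V : E → E} {a b L K : ℝ}

/-- The entropy of `F` under a Gaussian of small standard deviation `s`. -/
lemma exists_gaussianAverage_mul_log_sub_le (a L K : ℝ) :
    ∃ M : ℝ, ∀ {F : E → ℝ} {V : E → E} {b : ℝ}, BoundedTaylor F V a b L K →
    ∀ s : ℝ, 0 ≤ s → s ≤ 1 → ∀ x,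
    _root_.gaussianAverage s (fun z ↦ F z * log (F z)) x
      - _root_.gaussianAverage s F x * log (_root_.gaussianAverage s F x)
      ≤ s ^ 2 * (‖V x‖ ^ 2 / F x) + s ^ 3 * M := by
  -- `R` collects what remains after squaring `s * |⟪V x, y⟫| + s ^ 2 * K * ‖y‖ ^ 2`. It involves
  -- only `K` and `L`, so `M` can be fixed before `F`.
  set R : E → ℝ := fun y ↦ 2 * K * L * ‖y‖ ^ 3 + K ^ 2 * ‖y‖ ^ 4
  have iR : Integrable R (stdGaussian E) := ((integrable_norm_pow_stdGaussian 3).const_mul _).add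
    ((integrable_norm_pow_stdGaussian 4).const_mul _)
  refine ⟨(∫ y, R y ∂(stdGaussian E)) / a, fun {F V b} h s hs hs1 x ↦ ?_⟩
  set c := F x with hc
  have hc0 : 0 < c := h.pos' x
  have i₁ := integrable_gaussianAverage h.continuous h.norm_le s x
  obtain ⟨C, hC⟩ := h.exists_norm_mul_log_le
  have i₂ := integrable_gaussianAverage h.continuous_mul_log hC s x
  have i₃ : Integrable (fun y : E ↦ ⟪V x, y⟫ ^ 2) (stdGaussian E) := by
    refine ((integrable_norm_pow_stdGaussian 2).const_mul (‖V x‖ ^ 2)).mono'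
      (Measurable.aestronglyMeasurable (by fun_prop)) (ae_of_all _ fun y ↦ ?_)
    rw [norm_pow, ← mul_pow]
    gcongr
    exact norm_inner_le_norm _ _
  -- `K` itself need not be nonnegative, since `E` may be trivial; the Taylor bound only gives `0 ≤
  -- K * ‖y‖ ^ 2`.
  have hR (y : E) : 0 ≤ R y := by
    have := h.L_nonneg
    have hK : 0 ≤ K * ‖y‖ ^ 2 := (abs_nonneg _).trans (h.taylor x y)
    have : R y = 2 * (K * ‖y‖ ^ 2) * L * ‖y‖ + K ^ 2 * ‖y‖ ^ 4 := by simp only [R]; ring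
    rw [this]; positivity
  have key (y : E) : (F (x + s • y) - c) ^ 2 ≤ s ^ 2 * ⟪V x, y⟫ ^ 2 + s ^ 3 * R y := by
    have hK : 0 ≤ K * ‖y‖ ^ 2 := (abs_nonneg _).trans (h.taylor x y)
    have h₁ : |F (x + s • y) - c| ≤ s * |⟪V x, y⟫| + s ^ 2 * (K * ‖y‖ ^ 2) := by
      have := h.taylor x (s • y)
      rw [inner_smul_right, norm_smul, norm_of_nonneg hs] at this
      have h₂ := abs_sub_abs_le_abs_sub (F (x + s • y) - c) (s * ⟪V x, y⟫)
      rw [abs_mul, abs_of_nonneg hs] at h₂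
      nlinarith
    have h₃ : |⟪V x, y⟫| ≤ L * ‖y‖ := (abs_real_inner_le_norm _ _).trans
      (by gcongr; exact h.norm_grad_le x)
    have h₄ : |⟪V x, y⟫| * (K * ‖y‖ ^ 2) ≤ L * ‖y‖ * (K * ‖y‖ ^ 2) := by gcongr
    have h₅ : s ^ 4 * (K ^ 2 * ‖y‖ ^ 4) ≤ s ^ 3 * (K ^ 2 * ‖y‖ ^ 4) :=
      mul_le_mul_of_nonneg_right (pow_le_pow_of_le_one hs hs1 (by norm_num)) (by positivity)
    calc (F (x + s • y) - c) ^ 2 = |F (x + s • y) - c| ^ 2 := (sq_abs _).symm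
      _ ≤ (s * |⟪V x, y⟫| + s ^ 2 * (K * ‖y‖ ^ 2)) ^ 2 := by gcongr
      _ = s ^ 2 * |⟪V x, y⟫| ^ 2 + s ^ 3 * (2 * (|⟪V x, y⟫| * (K * ‖y‖ ^ 2)))
          + s ^ 4 * (K ^ 2 * ‖y‖ ^ 4) := by ring
      _ ≤ s ^ 2 * |⟪V x, y⟫| ^ 2 + s ^ 3 * (2 * (L * ‖y‖ * (K * ‖y‖ ^ 2)))
          + s ^ 3 * (K ^ 2 * ‖y‖ ^ 4) := by gcongr
      _ = _ := by rw [sq_abs]; simp only [R]; ring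
  have up : _root_.gaussianAverage s (fun z ↦ F z * log (F z)) x ≤ c * log c
      + (log c + 1) * (_root_.gaussianAverage s F x - c)
      + (s ^ 2 * ‖V x‖ ^ 2 + s ^ 3 * ∫ y, R y ∂(stdGaussian E)) / c := by
    have iA := (integrable_const (μ := stdGaussian E) (c * log c)).add
      ((i₁.sub (integrable_const c)).const_mul (log c + 1))
    have iB := ((i₃.const_mul (s ^ 2)).add (iR.const_mul (s ^ 3))).div_const c
    have := integral_mono i₂ (iA.add iB) fun y ↦
      (mul_log_le_mul_log_add hc0 (h.pos' (x + s • y))).trans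
        (add_le_add_right (div_le_div_of_nonneg_right (key y) hc0.le) _)
    rw [integral_add' iA iB, integral_add' (integrable_const _)
      ((i₁.sub (integrable_const c)).const_mul (log c + 1)), integral_const_mul (log c + 1),
      integral_sub' i₁ (integrable_const c), integral_div, integral_add' (i₃.const_mul (s ^ 2))
      (iR.const_mul (s ^ 3)), integral_const_mul (s ^ 2), integral_const_mul (s ^ 3),
      integral_inner_sq_stdGaussian] at this
    simpa using! this
  -- Both bounds use the tangent line at `c = F x`, so the affine terms cancel and only the
  -- quadratic one remains.
  have low := mul_log_add_le_mul_log hc0 ((h.gaussianAverage s).pos' x)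
  have hfin : (s ^ 2 * ‖V x‖ ^ 2 + s ^ 3 * ∫ y, R y ∂(stdGaussian E)) / c
      ≤ s ^ 2 * (‖V x‖ ^ 2 / c) + s ^ 3 * ((∫ y, R y ∂(stdGaussian E)) / a) := by
    rw [add_div, mul_div_assoc, mul_div_assoc]
    have : 0 ≤ ∫ y, R y ∂(stdGaussian E) := integral_nonneg hR
    have := h.pos
    gcongr
    exact h.lower x
  linarith

/-- Induction by the chain rule for entropy: with `t = √(m + 1) * s`, the new entropy is the
`t`-average of the one-step entropy of `F` plus the `t`-entropy of the `s`-average of `F`. The first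
is controlled by `hδ`, the second by the induction hypothesis and convexity of Fisher information.
The Fisher term lags one step behind because `hδ` evaluates it before averaging. -/
lemma gaussianAverage_mul_log_sub_le {s δ : ℝ} (hs : 0 ≤ s)
    (hδ : ∀ {F : E → ℝ} {V : E → E}, BoundedTaylor F V a b L K → ∀ x,
      _root_.gaussianAverage s (fun z ↦ F z * log (F z)) x
        - _root_.gaussianAverage s F x * log (_root_.gaussianAverage s F x)
        ≤ s ^ 2 * (‖V x‖ ^ 2 / F x) + δ) (m : ℕ) :
    ∀ {F : E → ℝ} {V : E → E}, BoundedTaylor F V a b L K → ∀ x,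
      _root_.gaussianAverage (√(m + 1) * s) (fun z ↦ F z * log (F z)) x
        - _root_.gaussianAverage (√(m + 1) * s) F x
          * log (_root_.gaussianAverage (√(m + 1) * s) F x)
        ≤ (m + 1) * (s ^ 2 * _root_.gaussianAverage (√m * s) (fun z ↦ ‖V z‖ ^ 2 / F z) x + δ) := by
  induction m with
  | zero =>
    intro F V h x
    simpa [_root_.gaussianAverage] using hδ h x
  | succ m ih =>
    intro F V h x
    obtain ⟨C, hC⟩ := h.exists_norm_mul_log_le
    obtain ⟨C', hC'⟩ := (h.gaussianAverage s).exists_norm_mul_log_le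
    have hsq (k : ℕ) : √(s ^ 2 + (√k * s) ^ 2) = √(k + 1 : ℕ) * s := by
      rw [mul_pow, sq_sqrt (by positivity)]
      rw [show s ^ 2 + (k : ℝ) * s ^ 2 = ((k + 1 : ℕ) : ℝ) * s ^ 2 by push_cast; ring,
        sqrt_mul (by positivity), sqrt_sq hs]
    have e₁ := gaussianAverage_gaussianAverage h.continuous h.norm_le s (√(m + 1 : ℕ) * s) x
    have e₂ := gaussianAverage_gaussianAverage h.continuous_mul_log hC s (√(m + 1 : ℕ) * s) x
    have e₃ := gaussianAverage_gaussianAverage h.continuous_fisher h.norm_fisher_le s (√m * s) x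
    rw [hsq] at e₁ e₂ e₃
    have h₁ := ih (h.gaussianAverage s) x
    have cont₁ := continuous_gaussianAverage h.continuous_fisher h.norm_fisher_le s
    have h₂ := gaussianAverage_mono (h.gaussianAverage s).continuous_fisher
      (h.gaussianAverage s).norm_fisher_le cont₁
      (norm_gaussianAverage_le h.norm_fisher_le s) (h.fisher_gaussianAverage_le s) (√m * s) x
    rw [e₃] at h₂
    set t := √(m + 1 : ℕ) * s with ht
    have it := integrable_gaussianAverage (continuous_gaussianAverage h.continuous_mul_log hC s)
      (norm_gaussianAverage_le hC s) t x
    have it' := integrable_gaussianAverage (h.gaussianAverage s).continuous_mul_log hC' t x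
    have it'' := integrable_gaussianAverage h.continuous_fisher h.norm_fisher_le t x
    have h₃ := integral_mono (it.sub it') ((it''.const_mul (s ^ 2)).add (integrable_const δ))
      fun y ↦ hδ h (x + t • y)
    rw [integral_sub' it it', integral_add' (it''.const_mul (s ^ 2)) (integrable_const δ),
      integral_const_mul] at h₃
    change _root_.gaussianAverage t (_root_.gaussianAverage s fun z ↦ F z * log (F z)) x
      - _root_.gaussianAverage t (fun z ↦ _root_.gaussianAverage s F z
        * log (_root_.gaussianAverage s F z)) x
      ≤ s ^ 2 * _root_.gaussianAverage t (fun z ↦ ‖V z‖ ^ 2 / F z) x + _ at h₃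
    simp only [integral_const, probReal_univ, one_smul] at h₃
    rw [e₂] at h₃
    have ht' : √((m : ℝ) + 1) * s = t := by rw [ht]; push_cast; rfl
    rw [ht', e₁] at h₁
    have h₄ := mul_le_mul_of_nonneg_left h₂ (show 0 ≤ ((m : ℝ) + 1) * s ^ 2 by positivity)
    have e₅ : √(((m + 1 : ℕ) : ℝ) + 1) = √((m + 1 + 1 : ℕ) : ℝ) := by push_cast; rfl
    rw [e₅]
    push_cast at *
    linarith

/-- The logarithmic Sobolev inequality in Fisher information form, for regular densities. -/
theorem entropy_le (h : BoundedTaylor F V a b L K) :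
    ∫ x, F x * log (F x) ∂(stdGaussian E)
      ≤ (∫ x, F x ∂(stdGaussian E)) * log (∫ x, F x ∂(stdGaussian E))
        + ∫ x, ‖V x‖ ^ 2 / F x ∂(stdGaussian E) := by
  obtain ⟨M, hM⟩ := exists_gaussianAverage_mul_log_sub_le (E := E) a L K
  -- With this `s`, the `m + 1` steps add up to unit variance, and the total error `(m + 1) * s ^ 3
  -- * M` is `s * M`.
  set s : ℕ → ℝ := fun m ↦ √(1 / ((m : ℝ) + 1)) with hs
  have hs0 (m : ℕ) : 0 ≤ s m := sqrt_nonneg _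
  have hs2 (m : ℕ) : s m ^ 2 = 1 / ((m : ℝ) + 1) := sq_sqrt (by positivity)
  have hs1 (m : ℕ) : s m ≤ 1 := by
    rw [hs, sqrt_le_one]
    exact div_le_one_of_le₀ (by simp) (by positivity)
  have hone (m : ℕ) : √((m : ℝ) + 1) * s m = 1 := by
    rw [hs, ← sqrt_mul (by positivity), mul_one_div_cancel (by positivity), sqrt_one]
  have hm (m : ℕ) : ∫ x, F x * log (F x) ∂(stdGaussian E)
      - (∫ x, F x ∂(stdGaussian E)) * log (∫ x, F x ∂(stdGaussian E))
      ≤ _root_.gaussianAverage (√m * s m) (fun z ↦ ‖V z‖ ^ 2 / F z) 0 + s m * M := by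
    have := gaussianAverage_mul_log_sub_le (hs0 m)
      (fun {F V} (h : BoundedTaylor F V a b L K) x ↦ hM h (s m) (hs0 m) (hs1 m) x) m h 0
    rw [hone] at this
    simp only [_root_.gaussianAverage, zero_add, one_smul] at this ⊢
    refine this.trans_eq ?_
    rw [pow_succ (s m) 2, hs2]
    field_simp
  have ht0 : Tendsto (fun m : ℕ ↦ 1 / ((m : ℝ) + 1)) atTop (𝓝 0) :=
    tendsto_one_div_add_atTop_nhds_zero_nat
  have hts : Tendsto s atTop (𝓝 0) := by
    simpa [Function.comp_def, hs] using! (continuous_sqrt.tendsto 0).comp ht0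
  have htt : Tendsto (fun m : ℕ ↦ √m * s m) atTop (𝓝 1) := by
    have e (m : ℕ) : √m * s m = √(1 - 1 / ((m : ℝ) + 1)) := by
      rw [hs, ← sqrt_mul (by positivity)]
      congr 1
      field_simp
      ring
    simp only [e]
    simpa [Function.comp_def] using (continuous_sqrt.tendsto _).comp (ht0.const_sub 1)
  have hlim : Tendsto (fun m : ℕ ↦ _root_.gaussianAverage (√m * s m) (fun z ↦ ‖V z‖ ^ 2 / F z) 0
      + s m * M) atTop (𝓝 (∫ x, ‖V x‖ ^ 2 / F x ∂(stdGaussian E))) := by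
    have : Tendsto (fun m : ℕ ↦ _root_.gaussianAverage (√m * s m) (fun z ↦ ‖V z‖ ^ 2 / F z) 0)
        atTop (𝓝 (∫ x, ‖V x‖ ^ 2 / F x ∂(stdGaussian E))) := by
      refine tendsto_integral_of_dominated_convergence (fun _ ↦ L ^ 2 / a)
        (fun m ↦ (integrable_gaussianAverage h.continuous_fisher h.norm_fisher_le
          (√m * s m) 0).aestronglyMeasurable)
        (integrable_const _) (fun m ↦ ae_of_all _ fun y ↦ h.norm_fisher_le _)
        (ae_of_all _ fun y ↦ ?_)
      have h₁ : Tendsto (fun m : ℕ ↦ (0 : E) + (√m * s m) • y) atTop (𝓝 y) := by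
        simpa using (htt.smul_const y).const_add 0
      exact (h.continuous_fisher.tendsto y).comp h₁
    simpa using this.add (hts.mul_const M)
  have := ge_of_tendsto' hlim hm
  linarith

end BoundedTaylor

end HeatFlow


/-! ### Lower semicontinuity of entropy. -/

lemma neg_one_le_mul_log {t : ℝ} (ht : 0 ≤ t) : -1 ≤ t * log t := by
  rcases ht.eq_or_lt with rfl | ht
  · simp
  · have := mul_log_add_le_mul_log one_pos ht
    simp only [log_one] at this
    linarith

/-- Lower semicontinuity of `u ↦ ∫ u² log u²` along almost everywhere convergence. -/
lemma integral_sq_mul_log_le_of_tendsto {Ω : Type*} [MeasurableSpace Ω] {μ : Measure Ω}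
    [IsProbabilityMeasure μ] {u : ℕ → Ω → ℝ} {v : Ω → ℝ} {D : ℕ → ℝ} {D₀ : ℝ}
    (hu : ∀ n, AEStronglyMeasurable (u n) μ)
    (huv : ∀ᵐ x ∂μ, Tendsto (fun n ↦ u n x) atTop (𝓝 (v x)))
    (hnorm : Tendsto (fun n ↦ ∫ x, u n x ^ 2 ∂μ) atTop (𝓝 (∫ x, v x ^ 2 ∂μ)))
    (hD : Tendsto D atTop (𝓝 D₀))
    (hint : ∀ n, Integrable (fun x ↦ u n x ^ 2 * log (u n x ^ 2)) μ)
    (hle : ∀ n, ∫ x, u n x ^ 2 * log (u n x ^ 2) ∂μ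
      ≤ (∫ x, u n x ^ 2 ∂μ) * log (∫ x, u n x ^ 2 ∂μ) + D n) :
    Integrable (fun x ↦ v x ^ 2 * log (v x ^ 2)) μ ∧
      ∫ x, v x ^ 2 * log (v x ^ 2) ∂μ
        ≤ (∫ x, v x ^ 2 ∂μ) * log (∫ x, v x ^ 2 ∂μ) + D₀ := by
  -- Adding 1 makes the integrand nonnegative, as Fatou's lemma requires; on a probability space
  -- this costs exactly 1.
  set k : ℝ → ℝ := fun t ↦ t ^ 2 * log (t ^ 2) + 1 with hk
  have hkc : Continuous k := (Real.continuous_mul_log.comp (continuous_pow 2)).add continuous_const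
  have hk0 (t : ℝ) : 0 ≤ k t := by have := neg_one_le_mul_log (sq_nonneg t); simp only [hk]; linarith
  have hv : AEStronglyMeasurable v μ := aestronglyMeasurable_of_tendsto_ae atTop hu huv
  have hkv : AEStronglyMeasurable (fun x ↦ k (v x)) μ := hkc.comp_aestronglyMeasurable hv
  set B : ℝ := (∫ x, v x ^ 2 ∂μ) * log (∫ x, v x ^ 2 ∂μ) + D₀ + 1 with hB
  have hBn : Tendsto (fun n ↦ (∫ x, u n x ^ 2 ∂μ) * log (∫ x, u n x ^ 2 ∂μ) + D n + 1) atTop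
      (𝓝 B) :=
    (((Real.continuous_mul_log.tendsto _).comp hnorm).add hD).add_const 1
  have hik (n : ℕ) : Integrable (fun x ↦ k (u n x)) μ := (hint n).add (integrable_const 1)
  have hikn (n : ℕ) : ∫ x, k (u n x) ∂μ
      ≤ (∫ x, u n x ^ 2 ∂μ) * log (∫ x, u n x ^ 2 ∂μ) + D n + 1 := by
    rw [integral_add (hint n) (integrable_const 1)]
    simpa using hle n
  have hB0 : 0 ≤ B := ge_of_tendsto' hBn fun n ↦ (integral_nonneg fun x ↦ hk0 _).trans (hikn n)
  have hfatou : ∫⁻ x, ENNReal.ofReal (k (v x)) ∂μ ≤ ENNReal.ofReal B := by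
    calc ∫⁻ x, ENNReal.ofReal (k (v x)) ∂μ
        = ∫⁻ x, liminf (fun n ↦ ENNReal.ofReal (k (u n x))) atTop ∂μ := by
          refine lintegral_congr_ae (huv.mono fun x hx ↦ ?_)
          exact (((ENNReal.continuous_ofReal.comp hkc).tendsto _).comp hx).liminf_eq.symm
      _ ≤ liminf (fun n ↦ ∫⁻ x, ENNReal.ofReal (k (u n x)) ∂μ) atTop :=
          lintegral_liminf_le' fun n ↦ (hik n).aemeasurable.ennreal_ofReal
      _ ≤ liminf (fun n ↦ ENNReal.ofReal
            ((∫ x, u n x ^ 2 ∂μ) * log (∫ x, u n x ^ 2 ∂μ) + D n + 1)) atTop := by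
          refine liminf_le_liminf (Eventually.of_forall fun n ↦ ?_)
          rw [← ofReal_integral_eq_lintegral_ofReal (hik n) (ae_of_all _ fun x ↦ hk0 _)]
          exact ENNReal.ofReal_le_ofReal (hikn n)
      _ = ENNReal.ofReal B := (((ENNReal.continuous_ofReal).tendsto _).comp hBn).liminf_eq
  have hint' : Integrable (fun x ↦ k (v x)) μ :=
    ⟨hkv, (hasFiniteIntegral_iff_ofReal (ae_of_all _ fun x ↦ hk0 _)).2
      (hfatou.trans_lt ENNReal.ofReal_lt_top)⟩
  have hi : Integrable (fun x ↦ v x ^ 2 * log (v x ^ 2)) μ := by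
    exact integrable_add_const_iff.1 hint'
  refine ⟨hi, ?_⟩
  rw [← ofReal_integral_eq_lintegral_ofReal hint' (ae_of_all _ fun x ↦ hk0 _),
    ENNReal.ofReal_le_ofReal_iff hB0, integral_add hi (integrable_const 1)] at hfatou
  simp only [integral_const, probReal_univ, one_smul, hB] at hfatou
  linarith

/-! ### The inequality for smooth compactly supported functions. -/

section Smooth

variable {E : Type*} [NormedAddCommGroup E] [InnerProductSpace ℝ E] [FiniteDimensional ℝ E]
  [MeasurableSpace E] [BorelSpace E]

/-- A smooth compactly supported nonnegative function plus a positive constant is admissible. -/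
lemma HasCompactSupport.exists_boundedTaylor {h : E → ℝ} (hs : HasCompactSupport h)
    (hc : ContDiff ℝ 2 h) (h0 : ∀ x, 0 ≤ h x) {ε : ℝ} (hε : 0 < ε) :
    ∃ b L K, BoundedTaylor (fun x ↦ h x + ε)
      (fun x ↦ (InnerProductSpace.toDual ℝ E).symm (fderiv ℝ h x)) ε b L K := by
  obtain ⟨b, hb⟩ := hs.exists_bound_of_continuous hc.continuous
  have hc' : ContDiff ℝ 1 (fderiv ℝ h) := hc.fderiv_right (by norm_num)
  obtain ⟨L, hL⟩ := (hs.fderiv ℝ).exists_bound_of_continuous hc'.continuous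
  obtain ⟨K, hK⟩ := hc'.lipschitzWith_of_hasCompactSupport (hs.fderiv ℝ) one_ne_zero
  refine ⟨b + ε, L, K, hε, hc.continuous.add continuous_const, fun x ↦ by linarith [h0 x],
    fun x ↦ by linarith [le_of_abs_le (hb x)],
    (LinearIsometryEquiv.continuous _).comp hc'.continuous, fun x ↦ ?_, fun x y ↦ ?_⟩
  · rw [LinearIsometryEquiv.norm_map]; exact hL x
  · rw [InnerProductSpace.toDual_symm_apply]
    have hx : x ∈ Metric.closedBall x ‖y‖ := by simp
    have hy : x + y ∈ Metric.closedBall x ‖y‖ := by simp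
    -- The derivative of `h` is `K`-Lipschitz, so on this ball it differs from its value at `x` by
    -- at most `K * ‖y‖`; the mean value inequality then gives the quadratic remainder.
    have := (convex_closedBall x ‖y‖).norm_image_sub_le_of_norm_hasFDerivWithin_le'
      (f := h) (f' := fderiv ℝ h) (φ := fderiv ℝ h x) (C := K * ‖y‖)
      (fun z _ ↦ (hc.differentiable (by norm_num) z).hasFDerivAt.hasFDerivWithinAt)
      (fun z hz ↦ (hK.norm_sub_le z x).trans (by
        gcongr; simpa [dist_eq_norm] using hz)) hx hy
    rw [norm_eq_abs, add_sub_cancel_left] at this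
    calc _ = |h (x + y) - h x - (fderiv ℝ h x) y| := by congr 1; ring
      _ ≤ K * ‖y‖ * ‖y‖ := this
      _ = _ := by ring

/-- The Gaussian logarithmic Sobolev inequality for smooth compactly supported functions. -/
theorem HasCompactSupport.integral_sq_mul_log_le {f : E → ℝ} (hs : HasCompactSupport f)
    (hf : ContDiff ℝ 2 f) :
    Integrable (fun x ↦ f x ^ 2 * log (f x ^ 2)) (stdGaussian E) ∧
      ∫ x, f x ^ 2 * log (f x ^ 2) ∂(stdGaussian E)
        ≤ (∫ x, f x ^ 2 ∂(stdGaussian E)) * log (∫ x, f x ^ 2 ∂(stdGaussian E))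
          + 4 * ∫ x, ‖fderiv ℝ f x‖ ^ 2 ∂(stdGaussian E) := by
  set h : E → ℝ := fun x ↦ f x ^ 2 with hh
  have hsh : HasCompactSupport h := hs.comp_left (g := fun t : ℝ ↦ t ^ 2) (by simp)
  have hch : ContDiff ℝ 2 h := hf.pow 2
  obtain ⟨b, hb⟩ := hsh.exists_bound_of_continuous hch.continuous
  have hb0 : 0 ≤ b := (norm_nonneg _).trans (hb 0)
  -- One bound serves every `ε ≤ 1`, including `ε = 0`, and dominates the limit `ε → 0`.
  obtain ⟨C, hC⟩ := (isCompact_Icc (a := (0 : ℝ)) (b := b + 1)).exists_bound_of_continuousOn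
    Real.continuous_mul_log.continuousOn
  have hbound (ε : ℝ) (hε0 : 0 ≤ ε) (hε : ε ≤ 1) (x : E) : ‖(h x + ε) * log (h x + ε)‖ ≤ C :=
    hC _ ⟨add_nonneg (sq_nonneg _) hε0, by linarith [le_of_abs_le (hb x)]⟩
  have ih : Integrable h (stdGaussian E) := integrable_stdGaussian_of_bounded hch.continuous hb
  have hcΦ (ε : ℝ) : Continuous fun x ↦ (h x + ε) * log (h x + ε) :=
    Real.continuous_mul_log.comp (hch.continuous.add continuous_const)
  have hcf' : Continuous (fderiv ℝ f) := hf.continuous_fderiv (by norm_num)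
  obtain ⟨M, hM⟩ := (hs.fderiv ℝ).exists_bound_of_continuous hcf'
  have if' : Integrable (fun x ↦ ‖fderiv ℝ f x‖ ^ 2) (stdGaussian E) :=
    integrable_stdGaussian_of_bounded (C := M ^ 2) (by fun_prop) fun x ↦ by
      rw [norm_pow, norm_norm]; gcongr; exact hM x
  refine ⟨by simpa only [add_zero] using
    integrable_stdGaussian_of_bounded (hcΦ 0) (hbound 0 le_rfl zero_le_one), ?_⟩
  set ε : ℕ → ℝ := fun n ↦ 1 / ((n : ℝ) + 1) with hε
  have hε0 (n : ℕ) : 0 < ε n := by positivity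
  have hε1 (n : ℕ) : ε n ≤ 1 := div_le_one_of_le₀ (by simp) (by positivity)
  have hεlim : Tendsto ε atTop (𝓝 0) := tendsto_one_div_add_atTop_nhds_zero_nat
  have hn (n : ℕ) : ∫ x, (h x + ε n) * log (h x + ε n) ∂(stdGaussian E)
      ≤ (∫ x, h x ∂(stdGaussian E) + ε n) * log (∫ x, h x ∂(stdGaussian E) + ε n)
        + 4 * ∫ x, ‖fderiv ℝ f x‖ ^ 2 ∂(stdGaussian E) := by
    obtain ⟨_, _, _, hT⟩ := hsh.exists_boundedTaylor hch (fun x ↦ sq_nonneg _) (hε0 n)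
    have := hT.entropy_le
    rw [integral_add ih (integrable_const _)] at this
    simp only [integral_const, probReal_univ, one_smul] at this
    refine this.trans (add_le_add_right ?_ _)
    rw [← integral_const_mul]
    refine integral_mono (integrable_stdGaussian_of_bounded hT.continuous_fisher hT.norm_fisher_le)
      (if'.const_mul 4) fun x ↦ ?_
    -- The constant 4 arises here: `‖∇(f ^ 2)‖ ^ 2 = 4 * f ^ 2 * ‖∇f‖ ^ 2`, and `f ^ 2 ≤ f ^ 2 + ε`.
    have hx : fderiv ℝ h x = (2 * f x) • fderiv ℝ f x := by
      rw [hh, fderiv_fun_pow 2 (hf.differentiable (by norm_num) x)]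
      simp [mul_smul]
    simp only [LinearIsometryEquiv.norm_map, hx, norm_smul, mul_pow, norm_mul]
    have hfx : ‖f x‖ ^ 2 = h x := by rw [norm_eq_abs, sq_abs]
    have h0 : 0 ≤ h x := sq_nonneg _
    rw [hfx, div_le_iff₀ (by linarith [hε0 n]), norm_ofNat]
    nlinarith [mul_nonneg (sq_nonneg ‖fderiv ℝ f x‖) (hε0 n).le]
  refine le_of_tendsto_of_tendsto' (b := atTop) ?_ ?_ hn
  · refine tendsto_integral_of_dominated_convergence (fun _ ↦ C)
      (fun n ↦ (integrable_stdGaussian_of_bounded (hcΦ (ε n))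
        (hbound _ (hε0 n).le (hε1 n))).aestronglyMeasurable) (integrable_const _)
      (fun n ↦ ae_of_all _ (hbound _ (hε0 n).le (hε1 n))) (ae_of_all _ fun x ↦ ?_)
    refine (Real.continuous_mul_log.tendsto _).comp ?_
    simpa using hεlim.const_add (h x)
  · refine Tendsto.add_const _ ((Real.continuous_mul_log.tendsto _).comp ?_)
    simpa using hεlim.const_add (∫ x, h x ∂(stdGaussian E))

end Smooth


/-! ### Gaussian density and mollification. -/

section Density

variable {E : Type*} [NormedAddCommGroup E] [InnerProductSpace ℝ E] [FiniteDimensional ℝ E]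
  [MeasurableSpace E] [BorelSpace E]
variable {H : Type*} [NormedAddCommGroup H] [InnerProductSpace ℝ H] [CompleteSpace H]

variable (E) in
/-- The normalizing constant of the standard Gaussian density. -/
noncomputable def gaussianConst : ℝ := (π / (1 / 2)) ^ (-(Module.finrank ℝ E / 2 : ℝ))

/-- The density of the standard Gaussian measure. -/
noncomputable def gaussianWeight (x : E) : ℝ := gaussianConst E * exp (-(1 / 2) * ‖x‖ ^ 2)

lemma gaussianConst_pos : 0 < gaussianConst E := by unfold gaussianConst; positivity

lemma gaussianWeight_pos (x : E) : 0 < gaussianWeight x :=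
  mul_pos gaussianConst_pos (exp_pos _)

lemma gaussianWeight_le (x : E) : gaussianWeight x ≤ gaussianConst E :=
  mul_le_of_le_one_right gaussianConst_pos.le (exp_le_one_iff.2 (by nlinarith [sq_nonneg ‖x‖]))

lemma continuous_gaussianWeight : Continuous (gaussianWeight : E → ℝ) := by
  unfold gaussianWeight; fun_prop

lemma integral_gaussianWeight : ∫ x : E, gaussianWeight x = 1 := by
  unfold gaussianWeight
  rw [integral_const_mul, GaussianFourier.integral_rexp_neg_mul_sq_norm (by norm_num),
    gaussianConst, ← rpow_add (by positivity)]
  simp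

lemma integrable_gaussianWeight : Integrable (gaussianWeight : E → ℝ) := by
  by_contra h
  have := integral_undef h
  rw [integral_gaussianWeight] at this
  exact one_ne_zero this

lemma stdGaussian_eq_withDensity :
    stdGaussian E = volume.withDensity fun x ↦ ENNReal.ofReal (gaussianWeight x) := by
  have : IsFiniteMeasure (volume.withDensity fun x : E ↦ ENNReal.ofReal (gaussianWeight x)) :=
    isFiniteMeasure_withDensity_ofReal integrable_gaussianWeight.2
  apply Measure.ext_of_charFun
  ext t
  rw [charFun_stdGaussian, charFun_apply, integral_withDensity_eq_integral_toReal_smul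
    (by exact continuous_gaussianWeight.measurable.ennreal_ofReal) (by simp)]
  have key := GaussianFourier.integral_cexp_neg_mul_sq_norm_add (V := E) (b := (1 / 2 : ℂ))
    (by norm_num) Complex.I t
  have e (x : E) : (ENNReal.ofReal (gaussianWeight x)).toReal • Complex.exp (⟪x, t⟫ * Complex.I)
      = gaussianConst E * Complex.exp (-(1 / 2) * ‖x‖ ^ 2 + Complex.I * ⟪t, x⟫) := by
    rw [ENNReal.toReal_ofReal (gaussianWeight_pos x).le, gaussianWeight, Complex.real_smul,
      Complex.exp_add, real_inner_comm]
    push_cast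
    ring_nf
  simp only [e]
  rw [integral_const_mul, key, gaussianConst, Complex.ofReal_cpow (by positivity), ← mul_assoc]
  push_cast
  rw [← Complex.cpow_add _ _ (by simp [pi_ne_zero])]
  simp only [neg_add_cancel, Complex.cpow_zero, one_mul, Complex.I_sq]
  congr 1
  ring

lemma stdGaussian_absolutelyContinuous : stdGaussian E ≪ (volume : Measure E) := by
  rw [stdGaussian_eq_withDensity]
  exact withDensity_absolutelyContinuous _ _

lemma integrable_stdGaussian_iff {F : E → ℝ} :
    Integrable F (stdGaussian E) ↔ Integrable fun x ↦ gaussianWeight x * F x := by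
  rw [stdGaussian_eq_withDensity, integrable_withDensity_iff_integrable_smul'
    (by exact continuous_gaussianWeight.measurable.ennreal_ofReal) (by simp)]
  simp only [ENNReal.toReal_ofReal (gaussianWeight_pos _).le, smul_eq_mul]

lemma integral_stdGaussian_eq (F : E → ℝ) :
    ∫ x, F x ∂(stdGaussian E) = ∫ x, gaussianWeight x * F x := by
  rw [stdGaussian_eq_withDensity, integral_withDensity_eq_integral_toReal_smul
    (by exact continuous_gaussianWeight.measurable.ennreal_ofReal) (by simp)]
  simp only [ENNReal.toReal_ofReal (gaussianWeight_pos _).le, smul_eq_mul]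

/-- The Gaussian density has a continuous inverse, hence one bounded on compact sets. -/
lemma locallyIntegrable_of_integrable_stdGaussian {F : E → ℝ}
    (hF : Integrable F (stdGaussian E)) : LocallyIntegrable F volume := by
  have := FiniteDimensional.proper_real E
  rw [locallyIntegrable_iff]
  intro K hK
  have h := ((integrable_stdGaussian_iff.1 hF).integrableOn (s := K)).continuousOn_mul
    (g := fun x ↦ (gaussianWeight x)⁻¹)
    (continuous_gaussianWeight.inv₀ fun x ↦ (gaussianWeight_pos x).ne').continuousOn hK
  refine h.congr (ae_of_all _ fun x ↦ ?_)
  have := (gaussianWeight_pos x).ne'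
  field_simp

lemma HasCompactSupport.integrable_of_integrable_stdGaussian {q : E → ℝ}
    (hs : HasCompactSupport q) (hq : Integrable q (stdGaussian E)) : Integrable q :=
  (integrableOn_iff_integrable_of_support_subset (subset_tsupport q)).1
    ((locallyIntegrable_of_integrable_stdGaussian hq).integrableOn_isCompact hs)

/-- Jensen's inequality for the probability density `φ.normed volume`, proved by integrating the
expansion of `‖v (x - t) - p‖ ^ 2 ≥ 0`. -/
lemma ContDiffBump.norm_convolution_sq_le (φ : ContDiffBump (0 : E)) {v : E → H}
    (hv : LocallyIntegrable v volume) (hv2 : LocallyIntegrable (fun x ↦ ‖v x‖ ^ 2) volume) (x : E) :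
    ‖convolution (φ.normed volume) v (ContinuousLinearMap.lsmul ℝ ℝ) volume x‖ ^ 2
      ≤ convolution (φ.normed volume) (fun x ↦ ‖v x‖ ^ 2) (ContinuousLinearMap.lsmul ℝ ℝ)
          volume x := by
  set p := convolution (φ.normed volume) v (ContinuousLinearMap.lsmul ℝ ℝ) volume x with hp
  have i₁ : Integrable fun t ↦ φ.normed volume t • v (x - t) :=
    φ.hasCompactSupport_normed.convolutionExists_left (ContinuousLinearMap.lsmul ℝ ℝ)
      φ.continuous_normed hv x
  have i₂ : Integrable fun t ↦ φ.normed volume t • ‖v (x - t)‖ ^ 2 :=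
    φ.hasCompactSupport_normed.convolutionExists_left (ContinuousLinearMap.lsmul ℝ ℝ)
      φ.continuous_normed hv2 x
  have i₃ : Integrable fun t ↦ φ.normed volume t := φ.integrable_normed
  have key (t : E) : 2 * ⟪p, φ.normed volume t • v (x - t)⟫ - ‖p‖ ^ 2 * φ.normed volume t
      ≤ φ.normed volume t • ‖v (x - t)‖ ^ 2 := by
    have h := mul_nonneg (φ.nonneg_normed (μ := volume) t) (sq_nonneg ‖v (x - t) - p‖)
    rw [norm_sub_sq_real, real_inner_comm] at h
    rw [inner_smul_right, smul_eq_mul]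
    linarith
  have := integral_mono (((i₁.const_inner p).const_mul 2).sub (i₃.const_mul (‖p‖ ^ 2))) i₂ key
  rw [integral_sub' ((i₁.const_inner p).const_mul 2) (i₃.const_mul (‖p‖ ^ 2)), integral_const_mul,
    integral_const_mul, integral_inner i₁, φ.integral_normed] at this
  change 2 * ⟪p, p⟫ - ‖p‖ ^ 2 * 1 ≤ _ at this
  rw [real_inner_self_eq_norm_sq] at this
  change ‖p‖ ^ 2 ≤ ∫ t, φ.normed volume t • ‖v (x - t)‖ ^ 2
  linarith

/-- A shrinking sequence of mollifiers. -/
noncomputable def mollifier (E : Type*) [NormedAddCommGroup E] (n : ℕ) : ContDiffBump (0 : E) where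
  rIn := 1 / ((n : ℝ) + 1)
  rOut := 2 * (1 / ((n : ℝ) + 1))
  rIn_pos := by positivity
  rIn_lt_rOut := by linarith [show (0 : ℝ) < 1 / ((n : ℝ) + 1) by positivity]

/-- Convolution of `v` with the `n`-th mollifier. -/
noncomputable def mollify (n : ℕ) (v : E → H) : E → H :=
  convolution ((mollifier E n).normed volume) v (ContinuousLinearMap.lsmul ℝ ℝ) volume

lemma tendsto_rOut_mollifier : Tendsto (fun n ↦ (mollifier E n).rOut) atTop (𝓝 0) := by
  simpa [mollifier] using (tendsto_one_div_add_atTop_nhds_zero_nat (𝕜 := ℝ)).const_mul 2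

/-- Lebesgue differentiation applies because the outer and inner radii keep the fixed ratio 2. -/
lemma ae_tendsto_mollify {v : E → H} (hv : LocallyIntegrable v volume) :
    ∀ᵐ x, Tendsto (fun n ↦ mollify n v x) atTop (𝓝 (v x)) :=
  ContDiffBump.ae_convolution_tendsto_right_of_locallyIntegrable tendsto_rOut_mollifier
    (K := 2) (Eventually.of_forall fun _ ↦ le_rfl) hv

lemma continuous_mollify {v : E → H} (hv : LocallyIntegrable v volume) (n : ℕ) :
    Continuous (mollify n v) :=
  (mollifier E n).hasCompactSupport_normed.continuous_convolution_left _
    (mollifier E n).continuous_normed hv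

/-- Fubini moves the mollifier from `q` to the Gaussian weight: the integral becomes the
mollification at 0 of the continuous function `T`, and `T 0` is the desired limit. -/
lemma tendsto_integral_mollify {q : E → ℝ} (hq : Integrable q) :
    (∀ n, Integrable (mollify n q) (stdGaussian E)) ∧
    Tendsto (fun n ↦ ∫ x, mollify n q x ∂(stdGaussian E)) atTop
      (𝓝 (∫ x, q x ∂(stdGaussian E))) := by
  set T : E → ℝ := fun s ↦ ∫ x, gaussianWeight (x - s) * q x with hT
  have hTc : Continuous T := by
    refine continuous_of_dominated (bound := fun x ↦ gaussianConst E * ‖q x‖)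
      (fun s ↦ ((continuous_gaussianWeight.comp
        (continuous_sub_right s)).aestronglyMeasurable.mul hq.aestronglyMeasurable))
      (fun s ↦ ae_of_all _ fun x ↦ ?_) (hq.norm.const_mul _) (ae_of_all _ fun x ↦ ?_)
    · rw [norm_mul, norm_of_nonneg (gaussianWeight_pos _).le]
      gcongr
      exact gaussianWeight_le _
    · exact (continuous_gaussianWeight.comp (by fun_prop)).mul continuous_const
  have hprod (n : ℕ) : Integrable (fun p : E × E ↦ gaussianWeight p.1 *
      ((mollifier E n).normed volume p.2 * q (p.1 - p.2))) (volume.prod volume) := by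
    have h := Integrable.convolution_integrand (ContinuousLinearMap.lsmul ℝ ℝ)
      ((mollifier E n).integrable_normed (μ := volume)) hq
    refine h.bdd_mul (c := gaussianConst E)
      (continuous_gaussianWeight.comp continuous_fst).aestronglyMeasurable (ae_of_all _ fun p ↦ ?_)
    exact (norm_of_nonneg (gaussianWeight_pos _).le).trans_le (gaussianWeight_le _)
  have hmul (n : ℕ) (x : E) : gaussianWeight x * mollify n q x = ∫ t, gaussianWeight x *
      ((mollifier E n).normed volume t * q (x - t)) := by
    rw [integral_const_mul]; rfl
  constructor
  · intro n
    rw [integrable_stdGaussian_iff]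
    simp only [hmul]
    exact (hprod n).integral_prod_left
  · have hlim := ContDiffBump.convolution_tendsto_right_of_continuous
      (μ := volume) (tendsto_rOut_mollifier (E := E)) hTc 0
    have e₀ : T 0 = ∫ x, q x ∂(stdGaussian E) := by
      rw [integral_stdGaussian_eq]; simp [hT]
    rw [e₀] at hlim
    refine hlim.congr fun n ↦ ?_
    rw [integral_stdGaussian_eq]
    simp only [hmul]
    rw [integral_integral_swap (hprod n)]
    refine integral_congr_ae (ae_of_all _ fun t ↦ ?_)
    have := integral_sub_right_eq_self (μ := volume) (fun x ↦ gaussianWeight (x + t) *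
      ((mollifier E n).normed volume t * q x)) t
    simp only [sub_add_cancel] at this
    simp only [this, hT, ContinuousLinearMap.lsmul_apply, smul_eq_mul, zero_sub, sub_neg_eq_add]
    rw [← integral_const_mul]
    congr 1
    ext x
    ring

/-- Mollification preserves `L²(γ)` norms in the limit. -/
lemma tendsto_integral_norm_sq_mollify {v : E → H} (hv : LocallyIntegrable v volume)
    (hv2 : Integrable fun x ↦ ‖v x‖ ^ 2) :
    Tendsto (fun n ↦ ∫ x, ‖mollify n v x‖ ^ 2 ∂(stdGaussian E)) atTop
      (𝓝 (∫ x, ‖v x‖ ^ 2 ∂(stdGaussian E))) := by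
  obtain ⟨hi, hlim⟩ := tendsto_integral_mollify hv2
  have hle (n : ℕ) (x : E) : ‖mollify n v x‖ ^ 2 ≤ mollify n (fun x ↦ ‖v x‖ ^ 2) x :=
    (mollifier E n).norm_convolution_sq_le hv hv2.locallyIntegrable x
  have hvm : AEStronglyMeasurable (fun x ↦ ‖v x‖ ^ 2) (stdGaussian E) :=
    hv2.aestronglyMeasurable.mono_ac stdGaussian_absolutelyContinuous
  have hi' (n : ℕ) : Integrable (fun x ↦ ‖mollify n v x‖ ^ 2) (stdGaussian E) :=
    (hi n).mono' ((continuous_mollify hv n).norm.pow 2).aestronglyMeasurable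
      (ae_of_all _ fun x ↦ by rw [norm_of_nonneg (by positivity)]; exact hle n x)
  have hiv : Integrable (fun x ↦ ‖v x‖ ^ 2) (stdGaussian E) := by
    rw [integrable_stdGaussian_iff]
    refine hv2.bdd_mul (c := gaussianConst E) continuous_gaussianWeight.aestronglyMeasurable
      (ae_of_all _ fun x ↦ ?_)
    rw [norm_of_nonneg (gaussianWeight_pos _).le]
    exact gaussianWeight_le _
  -- Fatou bounds the liminf from below; Jensen with `tendsto_integral_mollify` bounds the limsup
  -- from above.
  have hlow : ENNReal.ofReal (∫ x, ‖v x‖ ^ 2 ∂(stdGaussian E))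
      ≤ liminf (fun n ↦ ENNReal.ofReal (∫ x, ‖mollify n v x‖ ^ 2 ∂(stdGaussian E))) atTop := by
    simp only [ofReal_integral_eq_lintegral_ofReal (hi' _) (ae_of_all _ fun x ↦ sq_nonneg _),
      ofReal_integral_eq_lintegral_ofReal hiv (ae_of_all _ fun x ↦ sq_nonneg _)]
    calc ∫⁻ x, ENNReal.ofReal (‖v x‖ ^ 2) ∂(stdGaussian E)
        = ∫⁻ x, liminf (fun n ↦ ENNReal.ofReal (‖mollify n v x‖ ^ 2)) atTop ∂(stdGaussian E) := by
          refine lintegral_congr_ae (Eventually.mono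
            (stdGaussian_absolutelyContinuous.ae_le (ae_tendsto_mollify hv)) fun x hx ↦ ?_)
          exact ((ENNReal.continuous_ofReal.tendsto _).comp (hx.norm.pow 2)).liminf_eq.symm
      _ ≤ _ := lintegral_liminf_le' fun n ↦ (hi' n).aemeasurable.ennreal_ofReal
  have hup : limsup (fun n ↦ ENNReal.ofReal (∫ x, ‖mollify n v x‖ ^ 2 ∂(stdGaussian E))) atTop
      ≤ ENNReal.ofReal (∫ x, ‖v x‖ ^ 2 ∂(stdGaussian E)) := by
    rw [← ((ENNReal.continuous_ofReal.tendsto _).comp hlim).limsup_eq]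
    exact limsup_le_limsup (Eventually.of_forall fun n ↦
      ENNReal.ofReal_le_ofReal (integral_mono (hi' n) (hi n) (hle n)))
  have := (ENNReal.tendsto_toReal ENNReal.ofReal_ne_top).comp
    (tendsto_of_le_liminf_of_limsup_le hlow hup)
  simpa only [Function.comp_def, ENNReal.toReal_ofReal (integral_nonneg fun _ ↦ sq_nonneg _)]
    using this

end Density


/-! ### Weak gradients: mollification, cutoff and passage to the limit. -/

section WeakGradient

variable {d : ℕ} {f : EuclideanSpace ℝ (Fin d) → ℝ}
  {g : EuclideanSpace ℝ (Fin d) → EuclideanSpace ℝ (Fin d)}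

/-- The derivative falls on the mollifier, and the weak gradient is tested against `t ↦ ρ (x - t)`.
The sign from this reflection cancels the one from integration by parts. -/
lemma HasWeakGradient.fderiv_mollify (h : HasWeakGradient f g) (n : ℕ)
    (x y : EuclideanSpace ℝ (Fin d)) :
    fderiv ℝ (mollify n f) x y = ⟪mollify n g x, y⟫ := by
  obtain ⟨hf, hg, hfg⟩ := h
  set φ := mollifier (EuclideanSpace ℝ (Fin d)) n with hφ
  set ρ := φ.normed volume with hρ
  have hρs : HasCompactSupport ρ := φ.hasCompactSupport_normed
  have hρc : ContDiff ℝ ∞ ρ := φ.contDiff_normed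
  have hder := hρs.hasFDerivAt_convolution_left (ContinuousLinearMap.lsmul ℝ ℝ)
    (hρc.of_le (by exact_mod_cast le_top)) hf x
  have ex₁ := (hρs.fderiv ℝ).convolutionExists_left
    ((ContinuousLinearMap.lsmul ℝ ℝ : ℝ →L[ℝ] ℝ →L[ℝ] ℝ).precompL (EuclideanSpace ℝ (Fin d)))
    (hρc.continuous_fderiv (by simp)) hf x
  have ex₂ : Integrable fun t ↦ ρ t • g (x - t) :=
    hρs.convolutionExists_left (ContinuousLinearMap.lsmul ℝ ℝ) hρc.continuous hg x
  have e₁ : fderiv ℝ (mollify n f) x y = ∫ t, f t * fderiv ℝ ρ (x - t) y := by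
    have hd : fderiv ℝ (mollify n f) x = _ := hder.fderiv
    rw [hd, convolution, ContinuousLinearMap.integral_apply ex₁, ← integral_sub_left_eq_self _ _ x]
    refine integral_congr_ae (ae_of_all _ fun t ↦ ?_)
    simp [mul_comm]
  have e₂ : ⟪mollify n g x, y⟫ = ∫ t, ρ (x - t) * ⟪g t, y⟫ := by
    have : mollify n g x = ∫ t, ρ t • g (x - t) := rfl
    rw [this, real_inner_comm, ← integral_inner ex₂, ← integral_sub_left_eq_self _ _ x]
    refine integral_congr_ae (ae_of_all _ fun t ↦ ?_)
    simp only [sub_sub_cancel]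
    rw [inner_smul_right, real_inner_comm]
  have hψ := hfg (fun t ↦ ρ (x - t)) (hρc.comp (contDiff_const.sub contDiff_id))
    (hρs.comp_homeomorph (Homeomorph.subLeft x)) y
  have hd (t : EuclideanSpace ℝ (Fin d)) :
      fderiv ℝ (fun t ↦ ρ (x - t)) t y = -fderiv ℝ ρ (x - t) y := by
    have := ((hρc.differentiable (by simp)) (x - t)).hasFDerivAt.comp t
      ((hasFDerivAt_id t).const_sub x)
    rw [show (fun t ↦ ρ (x - t)) = ρ ∘ fun t ↦ x - t from rfl]
    erw [this.fderiv]
    simp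
  simp only [hd, mul_neg, integral_neg, neg_inj] at hψ
  rw [e₁, e₂, hψ]

lemma HasWeakGradient.integral_sq_mul_log_le_of_hasCompactSupport (h : HasWeakGradient f g)
    (hfs : HasCompactSupport f) (hf2 : Integrable fun x ↦ f x ^ 2)
    (hg2 : Integrable fun x ↦ ‖g x‖ ^ 2) :
    Integrable (fun x ↦ f x ^ 2 * log (f x ^ 2)) (stdGaussian (EuclideanSpace ℝ (Fin d))) ∧
      ∫ x, f x ^ 2 * log (f x ^ 2) ∂(stdGaussian (EuclideanSpace ℝ (Fin d)))
        ≤ (∫ x, f x ^ 2 ∂(stdGaussian (EuclideanSpace ℝ (Fin d))))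
            * log (∫ x, f x ^ 2 ∂(stdGaussian (EuclideanSpace ℝ (Fin d))))
          + 4 * ∫ x, ‖g x‖ ^ 2 ∂(stdGaussian (EuclideanSpace ℝ (Fin d))) := by
  have hs (n : ℕ) : HasCompactSupport (mollify n f) :=
    (mollifier _ n).hasCompactSupport_normed.convolution _ hfs
  have hc (n : ℕ) : ContDiff ℝ 2 (mollify n f) :=
    (mollifier _ n).hasCompactSupport_normed.contDiff_convolution_left (n := 2) _
      (mollifier _ n).contDiff_normed h.1
  have hgrad (n : ℕ) (x) : ‖fderiv ℝ (mollify n f) x‖ = ‖mollify n g x‖ := by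
    rw [← LinearIsometryEquiv.norm_map (InnerProductSpace.toDual ℝ _) (mollify n g x)]
    congr 1
    ext1 y
    rw [h.fderiv_mollify, InnerProductSpace.toDual_apply_apply]
  have hlsi (n : ℕ) := (hs n).integral_sq_mul_log_le (hc n)
  simp only [hgrad] at hlsi
  have hf2' := tendsto_integral_norm_sq_mollify h.1 (by simpa using hf2)
  simp only [norm_eq_abs, sq_abs] at hf2'
  exact integral_sq_mul_log_le_of_tendsto (fun n ↦ (hc n).continuous.aestronglyMeasurable)
    (stdGaussian_absolutelyContinuous.ae_le (ae_tendsto_mollify h.1)) hf2'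
    ((tendsto_integral_norm_sq_mollify h.2.1 hg2).const_mul 4) (fun n ↦ (hlsi n).1)
    fun n ↦ (hlsi n).2

/-- Leibniz rule for the product with a test function. -/
lemma HasWeakGradient.mul_smooth (h : HasWeakGradient f g) {χ : EuclideanSpace ℝ (Fin d) → ℝ}
    (hχ : ContDiff ℝ ∞ χ) (hs : HasCompactSupport χ) :
    HasWeakGradient (fun x ↦ χ x * f x)
      (fun x ↦ χ x • g x + f x • (InnerProductSpace.toDual ℝ _).symm (fderiv ℝ χ x)) := by
  obtain ⟨hf, hg, hfg⟩ := h
  have hχ' : Continuous (fderiv ℝ χ) := hχ.continuous_fderiv (by simp)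
  have hD : Continuous fun x ↦ (InnerProductSpace.toDual ℝ _).symm (fderiv ℝ χ x) :=
    (LinearIsometryEquiv.continuous _).comp hχ'
  have hDs : HasCompactSupport fun x ↦ (InnerProductSpace.toDual ℝ _).symm (fderiv ℝ χ x) :=
    (hs.fderiv ℝ).comp_left (map_zero _)
  refine ⟨(hf.integrable_smul_left_of_hasCompactSupport hχ.continuous hs).locallyIntegrable,
    ((hg.integrable_smul_left_of_hasCompactSupport hχ.continuous hs).add
    (hf.integrable_smul_right_of_hasCompactSupport hD hDs)).locallyIntegrable,
    fun φ hφ hφs v ↦ ?_⟩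
  have key := hfg (fun x ↦ χ x * φ x) (hχ.mul hφ) (hs.mul_right) v
  have hφ' : Continuous (fderiv ℝ φ) := hφ.continuous_fderiv (by simp)
  have hd (x) : fderiv ℝ (fun x ↦ χ x * φ x) x v = χ x * fderiv ℝ φ x v + φ x * fderiv ℝ χ x v := by
    rw [fderiv_fun_mul (hχ.differentiable (by simp) x) (hφ.differentiable (by simp) x)]
    simp
  have i₁ : Integrable fun x ↦ f x * (χ x * fderiv ℝ φ x v) :=
    hf.integrable_smul_right_of_hasCompactSupport (by fun_prop) hs.mul_right
  have i₂ : Integrable fun x ↦ f x * (φ x * fderiv ℝ χ x v) :=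
    hf.integrable_smul_right_of_hasCompactSupport (by fun_prop) hφs.mul_right
  have i₃ : Integrable fun x ↦ χ x * φ x * ⟪g x, v⟫ := by
    have := (hg.integrable_smul_left_of_hasCompactSupport
      (hχ.continuous.mul hφ.continuous) (hs.mul_right (f' := φ))).inner_const (𝕜 := ℝ) v
    simpa only [real_inner_smul_left] using! this
  simp only [hd, mul_add] at key
  rw [integral_add i₁ i₂] at key
  have e₁ : ∫ x, χ x * f x * fderiv ℝ φ x v = ∫ x, f x * (χ x * fderiv ℝ φ x v) := by
    congr 1; ext x; ring
  have e₂ : ∫ x, φ x * ⟪χ x • g x + f x • (InnerProductSpace.toDual ℝ _).symm (fderiv ℝ χ x), v⟫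
      = (∫ x, χ x * φ x * ⟪g x, v⟫) + ∫ x, f x * (φ x * fderiv ℝ χ x v) := by
    rw [← integral_add i₃ i₂]
    congr 1
    ext x
    rw [inner_add_left, real_inner_smul_left, real_inner_smul_left,
      InnerProductSpace.toDual_symm_apply]
    ring
  rw [e₁, e₂]
  linarith

/-- A smooth cutoff equal to one on the ball of radius `n + 1`. -/
noncomputable def cutoff (E : Type*) [NormedAddCommGroup E] [InnerProductSpace ℝ E]
    [FiniteDimensional ℝ E] (n : ℕ) (x : E) : ℝ :=
  (⟨1, 2, one_pos, one_lt_two⟩ : ContDiffBump (0 : E)) ((1 / ((n : ℝ) + 1)) • x)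

section Cutoff

variable {E : Type*} [NormedAddCommGroup E] [InnerProductSpace ℝ E] [FiniteDimensional ℝ E]

lemma contDiff_cutoff (n : ℕ) : ContDiff ℝ ∞ (cutoff E n) :=
  (ContDiffBump.contDiff _).comp (contDiff_const_smul _)

lemma hasCompactSupport_cutoff (n : ℕ) : HasCompactSupport (cutoff E n) :=
  (ContDiffBump.hasCompactSupport _).comp_homeomorph
    (Homeomorph.smulOfNeZero (1 / ((n : ℝ) + 1)) (by positivity))

lemma norm_cutoff_le (n : ℕ) (x : E) : ‖cutoff E n x‖ ≤ 1 := by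
  rw [cutoff, norm_of_nonneg (ContDiffBump.nonneg _)]
  exact ContDiffBump.le_one _

lemma tendsto_cutoff (x : E) : Tendsto (fun n ↦ cutoff E n x) atTop (𝓝 1) := by
  set φ : ContDiffBump (0 : E) := ⟨1, 2, one_pos, one_lt_two⟩
  have h : Tendsto (fun n : ℕ ↦ (1 / ((n : ℝ) + 1)) • x) atTop (𝓝 0) := by
    simpa using (tendsto_one_div_add_atTop_nhds_zero_nat (𝕜 := ℝ)).smul_const x
  have h0 : φ 0 = 1 := φ.one_of_mem_closedBall (by simp [φ])
  rw [← h0]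
  exact (φ.continuous.tendsto _).comp h

lemma exists_norm_fderiv_cutoff_le :
    ∃ M, ∀ n (x : E), ‖fderiv ℝ (cutoff E n) x‖ ≤ 1 / ((n : ℝ) + 1) * M := by
  set φ : ContDiffBump (0 : E) := ⟨1, 2, one_pos, one_lt_two⟩
  obtain ⟨M, hM⟩ := (φ.hasCompactSupport.fderiv ℝ).exists_bound_of_continuous
    (φ.contDiff (n := 1).continuous_fderiv one_ne_zero)
  refine ⟨M, fun n x ↦ ?_⟩
  have : fderiv ℝ (cutoff E n) x
      = (1 / ((n : ℝ) + 1)) • fderiv ℝ φ ((1 / ((n : ℝ) + 1)) • x) :=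
    fderiv_comp_smul (f := φ) _
  rw [this, norm_smul, norm_of_nonneg (by positivity)]
  gcongr
  exact hM _

/-- The gradient of the cutoff. -/
noncomputable def cutoffGradient (n : ℕ) (x : E) : E :=
  (InnerProductSpace.toDual ℝ E).symm (fderiv ℝ (cutoff E n) x)

lemma continuous_cutoffGradient (n : ℕ) : Continuous (cutoffGradient n : E → E) :=
  (LinearIsometryEquiv.continuous _).comp ((contDiff_cutoff n).continuous_fderiv (by simp))

lemma hasCompactSupport_cutoffGradient (n : ℕ) : HasCompactSupport (cutoffGradient n : E → E) :=
  ((hasCompactSupport_cutoff n).fderiv ℝ).comp_left (map_zero _)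

lemma exists_norm_cutoffGradient_le :
    ∃ M, ∀ n (x : E), ‖cutoffGradient n x‖ ≤ 1 / ((n : ℝ) + 1) * M := by
  obtain ⟨M, hM⟩ := exists_norm_fderiv_cutoff_le (E := E)
  exact ⟨M, fun n x ↦ (LinearIsometryEquiv.norm_map _ _).trans_le (hM n x)⟩

lemma hasCompactSupport_cutoff_smul_add (n : ℕ) (f : E → ℝ) (g : E → E) :
    HasCompactSupport fun x ↦ cutoff E n x • g x + f x • cutoffGradient n x := by
  have h₁ : HasCompactSupport (cutoff E n • g) := (hasCompactSupport_cutoff n).smul_right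
  have h₂ : HasCompactSupport (f • cutoffGradient n) :=
    (hasCompactSupport_cutoffGradient n).smul_left
  exact h₁.add h₂

end Cutoff

/-- `χₙ f` together with its weak gradient `χₙ g + f ∇χₙ`. -/
lemma HasWeakGradient.cutoff_mul (h : HasWeakGradient f g) (n : ℕ) :
    HasWeakGradient (fun x ↦ cutoff _ n x * f x)
      (fun x ↦ cutoff _ n x • g x + f x • cutoffGradient n x) :=
  h.mul_smooth (contDiff_cutoff n) (hasCompactSupport_cutoff n)

/-- Cutting off turns Gaussian square integrability into Lebesgue square integrability, as the
mollification argument needs. The extra term `f ∇χₙ` vanishes in the limit because `∇χₙ` is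
`O(1/n)`. -/
theorem HasWeakGradient.integral_sq_mul_log_le (h : HasWeakGradient f g)
    (hf : MemLp f 2 (stdGaussian (EuclideanSpace ℝ (Fin d))))
    (hg : MemLp g 2 (stdGaussian (EuclideanSpace ℝ (Fin d)))) :
    Integrable (fun x ↦ f x ^ 2 * log (f x ^ 2)) (stdGaussian (EuclideanSpace ℝ (Fin d))) ∧
      ∫ x, f x ^ 2 * log (f x ^ 2) ∂(stdGaussian (EuclideanSpace ℝ (Fin d)))
        ≤ (∫ x, f x ^ 2 ∂(stdGaussian (EuclideanSpace ℝ (Fin d))))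
            * log (∫ x, f x ^ 2 ∂(stdGaussian (EuclideanSpace ℝ (Fin d))))
          + 4 * ∫ x, ‖g x‖ ^ 2 ∂(stdGaussian (EuclideanSpace ℝ (Fin d))) := by
  have hf2 : Integrable (fun x ↦ f x ^ 2) (stdGaussian _) := hf.integrable_sq
  have hg2 : Integrable (fun x ↦ ‖g x‖ ^ 2) (stdGaussian _) := hg.norm.integrable_sq
  obtain ⟨M, hM⟩ := exists_norm_cutoffGradient_le (E := EuclideanSpace ℝ (Fin d))
  have hM0 : 0 ≤ M := by simpa using (norm_nonneg _).trans (hM 0 0)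
  set u : ℕ → EuclideanSpace ℝ (Fin d) → ℝ := fun n x ↦ cutoff _ n x * f x with hu
  set V : ℕ → EuclideanSpace ℝ (Fin d) → EuclideanSpace ℝ (Fin d) :=
    fun n x ↦ cutoff _ n x • g x + f x • cutoffGradient n x with hV
  have hw (n : ℕ) : HasWeakGradient (u n) (V n) := h.cutoff_mul n
  have hnorm_f (n : ℕ) (x : EuclideanSpace ℝ (Fin d)) :
      ‖f x • cutoffGradient n x‖ ≤ |f x| * (1 / ((n : ℝ) + 1) * M) := by
    rw [norm_smul, norm_eq_abs]
    gcongr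
    exact hM n x
  have hVle (n : ℕ) (x : EuclideanSpace ℝ (Fin d)) : ‖V n x‖ ^ 2 ≤
      2 * ‖g x‖ ^ 2 + 2 * M ^ 2 * f x ^ 2 := by
    have h₁ : ‖cutoff _ n x • g x‖ ≤ ‖g x‖ := by
      rw [norm_smul]
      exact mul_le_of_le_one_left (norm_nonneg _) (norm_cutoff_le n x)
    have h₂ : |f x| * (1 / ((n : ℝ) + 1) * M) ≤ |f x| * M := by
      gcongr
      exact mul_le_of_le_one_left hM0 (div_le_one_of_le₀ (by simp) (by positivity))
    have h₃ : ‖V n x‖ ≤ ‖g x‖ + |f x| * M :=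
      (norm_add_le _ _).trans (add_le_add h₁ ((hnorm_f n x).trans h₂))
    calc ‖V n x‖ ^ 2 ≤ (‖g x‖ + |f x| * M) ^ 2 := by gcongr
      _ ≤ 2 * ‖g x‖ ^ 2 + 2 * M ^ 2 * |f x| ^ 2 := by nlinarith [sq_nonneg (‖g x‖ - |f x| * M)]
      _ = _ := by rw [sq_abs]
  have hule (n : ℕ) (x : EuclideanSpace ℝ (Fin d)) : u n x ^ 2 ≤ f x ^ 2 := by
    rw [hu, mul_pow]
    refine mul_le_of_le_one_left (sq_nonneg _) ?_
    rw [← sq_abs, ← norm_eq_abs]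
    exact pow_le_one₀ (norm_nonneg _) (norm_cutoff_le n x)
  have hum (n : ℕ) : AEStronglyMeasurable (u n) (stdGaussian _) :=
    (contDiff_cutoff n).continuous.aestronglyMeasurable.mul hf.aestronglyMeasurable
  have hVm (n : ℕ) : AEStronglyMeasurable (V n) (stdGaussian _) :=
    ((contDiff_cutoff n).continuous.aestronglyMeasurable.smul hg.aestronglyMeasurable).add
      (hf.aestronglyMeasurable.smul
        (continuous_cutoffGradient n).aestronglyMeasurable)
  have hbound : Integrable (fun x ↦ 2 * ‖g x‖ ^ 2 + 2 * M ^ 2 * f x ^ 2) (stdGaussian _) :=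
    (hg2.const_mul 2).add (hf2.const_mul _)
  have hV2 (n : ℕ) : Integrable (fun x ↦ ‖V n x‖ ^ 2) (stdGaussian _) :=
    hbound.mono' ((hVm n).norm.pow 2) (ae_of_all _ fun x ↦ by
      rw [norm_of_nonneg (sq_nonneg _)]; exact hVle n x)
  have hu2 (n : ℕ) : Integrable (fun x ↦ u n x ^ 2) (stdGaussian _) :=
    hf2.mono' ((hum n).pow 2) (ae_of_all _ fun x ↦ by
      rw [norm_of_nonneg (sq_nonneg _)]; exact hule n x)
  have hus (n : ℕ) : HasCompactSupport (u n) := (hasCompactSupport_cutoff n).mul_right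
  have hVs (n : ℕ) : HasCompactSupport (V n) := hasCompactSupport_cutoff_smul_add n f g
  have hus2 (n : ℕ) : HasCompactSupport fun x ↦ u n x ^ 2 :=
    (hus n).comp_left (g := fun t : ℝ ↦ t ^ 2) (by simp)
  have hVs2 (n : ℕ) : HasCompactSupport fun x ↦ ‖V n x‖ ^ 2 :=
    (hVs n).comp_left (g := fun t : EuclideanSpace ℝ (Fin d) ↦ ‖t‖ ^ 2) (by simp)
  have hlsi (n : ℕ) := (hw n).integral_sq_mul_log_le_of_hasCompactSupport (hus n)
    ((hus2 n).integrable_of_integrable_stdGaussian (hu2 n))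
    ((hVs2 n).integrable_of_integrable_stdGaussian (hV2 n))
  have hulim (x : EuclideanSpace ℝ (Fin d)) : Tendsto (fun n ↦ u n x) atTop (𝓝 (f x)) := by
    simpa using (tendsto_cutoff x).mul_const (f x)
  have hVlim (x : EuclideanSpace ℝ (Fin d)) : Tendsto (fun n ↦ V n x) atTop (𝓝 (g x)) := by
    have h₁ : Tendsto (fun n ↦ f x • cutoffGradient n x)
        atTop (𝓝 0) := by
      refine squeeze_zero_norm (fun n ↦ hnorm_f n x) ?_
      simpa using ((tendsto_one_div_add_atTop_nhds_zero_nat (𝕜 := ℝ)).mul_const M).const_mul |f x|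
    simpa using ((tendsto_cutoff x).smul_const (g x)).add h₁
  refine integral_sq_mul_log_le_of_tendsto hum (ae_of_all _ hulim) ?_
    (D := fun n ↦ 4 * ∫ x, ‖V n x‖ ^ 2 ∂(stdGaussian _)) (Tendsto.const_mul 4 ?_)
    (fun n ↦ (hlsi n).1) fun n ↦ (hlsi n).2
  · exact tendsto_integral_of_dominated_convergence (fun x ↦ f x ^ 2)
      (fun n ↦ (hu2 n).aestronglyMeasurable) hf2 (fun n ↦ ae_of_all _ fun x ↦ by
        rw [norm_of_nonneg (sq_nonneg _)]; exact hule n x)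
      (ae_of_all _ fun x ↦ (hulim x).pow 2)
  · exact tendsto_integral_of_dominated_convergence _
      (fun n ↦ (hV2 n).aestronglyMeasurable) hbound (fun n ↦ ae_of_all _ fun x ↦ by
        rw [norm_of_nonneg (sq_nonneg _)]; exact hVle n x)
      (ae_of_all _ fun x ↦ (hVlim x).norm.pow 2)

end WeakGradient

theorem mainTheorem3 :
    ∃ C : ℝ, 0 < C ∧
      ∀ (d : ℕ) (f : EuclideanSpace ℝ (Fin d) → ℝ)
        (g : EuclideanSpace ℝ (Fin d) → EuclideanSpace ℝ (Fin d)),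
        MemLp f 2 (stdGaussian (EuclideanSpace ℝ (Fin d))) →
        MemLp g 2 (stdGaussian (EuclideanSpace ℝ (Fin d))) →
        HasWeakGradient f g →
          Integrable (fun x => f x ^ 2 *
              Real.log (f x ^ 2 / ∫ y, f y ^ 2 ∂(stdGaussian (EuclideanSpace ℝ (Fin d)))))
            (stdGaussian (EuclideanSpace ℝ (Fin d))) ∧
          ∫ x, f x ^ 2 *
              Real.log (f x ^ 2 / ∫ y, f y ^ 2 ∂(stdGaussian (EuclideanSpace ℝ (Fin d))))
              ∂(stdGaussian (EuclideanSpace ℝ (Fin d))) ≤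
            C * ∫ x, ‖g x‖ ^ 2 ∂(stdGaussian (EuclideanSpace ℝ (Fin d))) := by
  refine ⟨4, by norm_num, fun d f g hf hg h ↦ ?_⟩
  set γ := stdGaussian (EuclideanSpace ℝ (Fin d))
  set m := ∫ y, f y ^ 2 ∂γ with hm
  -- If `m = 0`, division by zero and `log 0 = 0` make the integrand identically zero.
  rcases eq_or_ne m 0 with h0 | h0
  · simp only [h0, div_zero, log_zero, mul_zero, integral_zero]
    exact ⟨integrable_zero _ _ _, by positivity⟩
  -- Where `f x = 0` the logarithm does not split, but the factor `f x ^ 2` annihilates every term.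
  have e (x) : f x ^ 2 * log (f x ^ 2 / m) = f x ^ 2 * log (f x ^ 2) - f x ^ 2 * log m := by
    rcases eq_or_ne (f x ^ 2) 0 with hx | hx
    · simp [hx]
    · rw [log_div hx h0, mul_sub]
  obtain ⟨hi, hle⟩ := h.integral_sq_mul_log_le hf hg
  have hi' : Integrable (fun x ↦ f x ^ 2 * log m) γ := hf.integrable_sq.mul_const _
  simp only [e]
  refine ⟨hi.sub hi', ?_⟩
  rw [integral_sub hi hi', integral_mul_const, ← hm]
  linarith
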